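/- Fix an integer $k\ge 1$. A partition $\lambda=(\lambda_1\ge\lambda_2\ge\cdots)$ is $k$-bounded if $\lambda_1\le k$. Its diagram has $\lambda_i$ cells in row $i$, rows being numbered from bottom to top, and $\lambda\subseteq\mu$ means $\lambda_i\le\mu_i$ for all $i$; $|\lambda|=\sum_i\lambda_i$. In a skew diagram $D=\gamma/\rho$ (with $\rho\subseteq\gamma$), the hook-length of a square $s\in\gamma$ is the number of cells of $D$ that lie weakly to the right of $s$ in its row or weakly above $s$ in its column. For a $k$-bounded partition $\lambda$ there is a unique skew diagram $D=\gamma/\rho$, written $\lambda/^k$, such that row $i$ of $D$ has $\lambda_i$ cells for every $i$, every cell of $D$ has hook-length at most $k$, and every square of $\rho$ has hook-length greater than $k$. The column lengths of $\lambda/^k$ form a $k$-bounded partition, the $k$-conjugate $\lambda^{\omega_k}$. For $k$-bounded $\lambda,\mu$ write $\lambda\prec\!\!\cdot\,\mu$ if $\lambda\subseteq\mu$, $\lambda^{\omega_k}\subseteq\mu^{\omega_k}$ and $|\mu|=|\lambda|+1$. The order $\preceq$ of the $k$-Young lattice is the reflexive and transitive closure of $\prec\!\!\cdot$ on the set of $k$-bounded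 partitions. Let $\lambda\cup\mu$ denote the partition whose parts are those of $\lambda$ together with those of $\mu$ (with multiplicities), in weakly decreasing order. Theorem. Let $1\le \ell\le k$, let $\square=(\ell^{\,k-\ell+1})$ be the rectangle with $k-\ell+1$ rows of length $\ell$, and let $\lambda,\mu$ be $k$-bounded partitions. Then $$\lambda\cup\square\preceq\mu\iff \mu=\bar\mu\cup\square\ \text{ and }\ \lambda\preceq\bar\mu\ \text{ for some $k$-bounded partition }\bar\mu .$$ The same holds for covers: $$\lambda\cup\square\prec\!\!\cdot\,\mu\iff \mu=\bar\mu\cup\square\ \text{ and }\ \lambda\prec\!\!\cdot\,\bar\mu\ \text{ for some $k$-bounded partition }\bar\mu .$$ -/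

import Mathlib

/-! Partitions are Young diagrams; the cell `(i, j)` lies in row `i` and column `j`, both counted
from `0`.  Row `0` is the longest row, drawn at the bottom, so "higher" means a larger row index. -/

namespace KYoung

/-- A skew diagram `outer / inner`. -/
@[ext]
structure SkewDiagram where
  outer : YoungDiagram
  inner : YoungDiagram
  inner_le : inner ≤ outer

namespace SkewDiagram

/-- The cells of the skew diagram. -/
def cells (D : SkewDiagram) : Finset (ℕ × ℕ) := D.outer.cells \ D.inner.cells

/-- The number of cells in row `i`. -/
def rowCount (D : SkewDiagram) (i : ℕ) : ℕ := (D.cells.filter fun c => c.1 = i).card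

/-- The number of cells in column `j`. -/
def colCount (D : SkewDiagram) (j : ℕ) : ℕ := (D.cells.filter fun c => c.2 = j).card

/-- The hook of a square `s` (a cell of the skew diagram or a square below it): the cells of the
skew diagram that are weakly to the right of `s` in its row or weakly above `s` in its column. -/
def hook (D : SkewDiagram) (s : ℕ × ℕ) : Finset (ℕ × ℕ) :=
  D.cells.filter fun c => (c.1 = s.1 ∧ s.2 ≤ c.2) ∨ (c.2 = s.2 ∧ s.1 ≤ c.1)

/-- The hook-length of a square. -/
def hookLength (D : SkewDiagram) (s : ℕ × ℕ) : ℕ := (D.hook s).card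

end SkewDiagram

/-- A `k`-bounded partition: all its parts are at most `k`. -/
@[ext]
structure KBoundedPartition (k : ℕ) where
  diagram : YoungDiagram
  bounded : diagram.rowLen 0 ≤ k

/-- `D` is a `k`-skew diagram of the partition `lam`: the rows of `D` have the lengths of the rows
of `lam`, no cell of `D` has hook-length exceeding `k`, and every square below `D` has. -/
structure IsKSkew (k : ℕ) (lam : YoungDiagram) (D : SkewDiagram) : Prop where
  row : ∀ i, D.rowCount i = lam.rowLen i
  cell_hook : ∀ s ∈ D.cells, D.hookLength s ≤ k
  below_hook : ∀ s ∈ D.inner.cells, k < D.hookLength s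

/-! ### Existence and uniqueness of the `k`-skew diagram -/

/-- The Young diagram with row lengths `f 0 ≥ f 1 ≥ ⋯`. -/
def ofRows (f : ℕ → ℕ) (hf : Antitone f) (N : ℕ) (hN : f N = 0) : YoungDiagram where
  cells := (Finset.range N ×ˢ Finset.range (f 0)).filter fun c => c.2 < f c.1
  isLowerSet := by
    rintro ⟨a, b⟩ ⟨c, d⟩ ⟨h1, h2⟩ h
    simp only [Finset.coe_filter, Finset.mem_product, Finset.mem_range, Set.mem_ofPred_eq] at h ⊢
    simp only at h1 h2
    have := hf h1
    have := hf (Nat.zero_le c)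
    omega

theorem mem_ofRows {f : ℕ → ℕ} {hf : Antitone f} {N : ℕ} {hN : f N = 0} {i j : ℕ} :
    (i, j) ∈ ofRows f hf N hN ↔ j < f i := by
  rw [← YoungDiagram.mem_cells]
  simp only [ofRows, Finset.mem_filter, Finset.mem_product, Finset.mem_range, and_iff_right_iff_imp]
  intro h
  have h0 := hf (Nat.zero_le i)
  refine ⟨?_, by omega⟩
  by_contra hi
  have := hf (not_lt.mp hi)
  omega

theorem rowLen_ofRows (f : ℕ → ℕ) (hf : Antitone f) (N : ℕ) (hN : f N = 0) (i : ℕ) :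
    (ofRows f hf N hN).rowLen i = f i := by
  refine le_antisymm ?_ ?_ <;> by_contra! h
  · have := mem_ofRows.mp (YoungDiagram.mem_iff_lt_rowLen.mpr h)
    omega
  · have := YoungDiagram.mem_iff_lt_rowLen.mp ((mem_ofRows (hf := hf) (hN := hN)).mpr h)
    omega

theorem rowLen_colLen_zero (Y : YoungDiagram) : Y.rowLen (Y.colLen 0) = 0 := by
  by_contra h
  have h1 := YoungDiagram.mem_iff_lt_rowLen.mpr (Nat.pos_of_ne_zero h)
  exact absurd (YoungDiagram.mem_iff_lt_colLen.mp h1) (lt_irrefl _)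

namespace SkewDiagram

theorem mem_cells_iff {D : SkewDiagram} {i j : ℕ} :
    (i, j) ∈ D.cells ↔ D.inner.rowLen i ≤ j ∧ j < D.outer.rowLen i := by
  simp only [cells, Finset.mem_sdiff, YoungDiagram.mem_cells, YoungDiagram.mem_iff_lt_rowLen]
  omega

theorem inner_rowLen_le (D : SkewDiagram) (i : ℕ) : D.inner.rowLen i ≤ D.outer.rowLen i := by
  by_contra! h
  have := YoungDiagram.mem_iff_lt_rowLen.mp (D.inner_le (YoungDiagram.mem_iff_lt_rowLen.mpr h))
  omega

/-- The cells of column `j` in the rows with index at least `i`. -/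
def colFrom (D : SkewDiagram) (i j : ℕ) : Finset (ℕ × ℕ) :=
  D.cells.filter fun c => c.2 = j ∧ i ≤ c.1

theorem rowCount_eq (D : SkewDiagram) (i : ℕ) :
    D.rowCount i = D.outer.rowLen i - D.inner.rowLen i := by
  have h : (D.cells.filter fun c => c.1 = i) =
      (Finset.Ico (D.inner.rowLen i) (D.outer.rowLen i)).image (fun j => (i, j)) := by
    ext ⟨a, b⟩
    simp only [Finset.mem_filter, mem_cells_iff, Finset.mem_image, Finset.mem_Ico, Prod.mk.injEq]
    constructor
    · rintro ⟨h, rfl⟩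
      exact ⟨b, h, rfl, rfl⟩
    · rintro ⟨j, h, rfl, rfl⟩
      exact ⟨h, rfl⟩
  rw [rowCount, h, Finset.card_image_of_injective _ (fun a b h => (Prod.mk.inj h).2), Nat.card_Ico]

theorem hookLength_eq (D : SkewDiagram) (i j : ℕ) :
    D.hookLength (i, j) =
      (D.outer.rowLen i - max j (D.inner.rowLen i)) + (D.colFrom (i + 1) j).card := by
  have h : D.hook (i, j) =
      (Finset.Ico (max j (D.inner.rowLen i)) (D.outer.rowLen i)).image (fun j => (i, j)) ∪
        D.colFrom (i + 1) j := by
    ext ⟨a, b⟩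
    simp only [hook, colFrom, Finset.mem_union, Finset.mem_filter, mem_cells_iff, Finset.mem_image,
      Finset.mem_Ico, Prod.mk.injEq]
    constructor
    · rintro ⟨h, ⟨rfl, h2⟩ | ⟨rfl, h2⟩⟩
      · exact Or.inl ⟨b, by omega, rfl, rfl⟩
      · rcases Nat.lt_or_ge i a with h3 | h3
        · exact Or.inr ⟨h, rfl, h3⟩
        · obtain rfl : a = i := by omega
          exact Or.inl ⟨b, by omega, rfl, rfl⟩
    · rintro (⟨j', h, rfl, rfl⟩ | ⟨h, rfl, h2⟩)
      · exact ⟨by omega, Or.inl ⟨rfl, by omega⟩⟩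
      · exact ⟨h, Or.inr ⟨rfl, by omega⟩⟩
  rw [hookLength, h, Finset.card_union_of_disjoint,
    Finset.card_image_of_injective _ (fun a b h => (Prod.mk.inj h).2), Nat.card_Ico]
  rw [Finset.disjoint_left]
  rintro ⟨a, b⟩ h1 h2
  simp only [colFrom, Finset.mem_filter, Finset.mem_image, Prod.mk.injEq] at h1 h2
  obtain ⟨_, _, rfl, _⟩ := h1
  omega

theorem colFrom_card (D : SkewDiagram) (i j N : ℕ) (hN : D.outer.rowLen N = 0) :
    (D.colFrom i j).card = ((Finset.Ico i N).filter
      (fun a => D.inner.rowLen a ≤ j ∧ j < D.outer.rowLen a)).card := by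
  rw [← Finset.card_image_of_injective (f := fun a => (a, j))
    ((Finset.Ico i N).filter _) (fun a b h => (Prod.mk.inj h).1)]
  refine congrArg Finset.card ?_
  ext ⟨a, b⟩
  simp only [colFrom, Finset.mem_filter, mem_cells_iff, Finset.mem_image, Finset.mem_Ico,
    Prod.mk.injEq]
  constructor
  · rintro ⟨h, rfl, h2⟩
    refine ⟨a, ⟨⟨h2, ?_⟩, h⟩, rfl, rfl⟩
    by_contra! h3
    have := D.outer.rowLen_anti _ _ h3
    omega
  · rintro ⟨a', ⟨h1, h2⟩, rfl, rfl⟩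
    exact ⟨h2, rfl, h1.1⟩

theorem colCount_eq (D : SkewDiagram) (j : ℕ) : D.colCount j = (D.colFrom 0 j).card := by
  simp [colCount, colFrom]

theorem colCount_eq_zero (D : SkewDiagram) {j : ℕ} (hj : D.outer.rowLen 0 ≤ j) :
    D.colCount j = 0 := by
  rw [colCount, Finset.card_eq_zero, Finset.filter_eq_empty_iff]
  rintro ⟨a, b⟩ h1 (rfl : b = j)
  have := D.outer.rowLen_anti 0 a (Nat.zero_le _)
  have := (mem_cells_iff.mp h1).2
  omega

end SkewDiagram

open SkewDiagram

/-- The recursive construction of the first columns of the rows of the `k`-skew diagram, from the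
highest row downwards. -/
theorem exists_starts (k N : ℕ) (r : ℕ → ℕ) (hr : Antitone r) (hN : r N = 0) (hk : r 0 ≤ k)
    (m : ℕ) (hm : m ≤ N) : ∃ s : ℕ → ℕ,
      s N = 0 ∧ (∀ a b, m ≤ a → a ≤ b → b ≤ N → s b ≤ s a ∧ s b + r b ≤ s a + r a) ∧
      (Antitone fun j => ((Finset.Ico m N).filter fun a => s a ≤ j ∧ j < s a + r a).card) ∧
      (∀ i, m ≤ i → i < N → ∀ j,
        (s i ≤ j → r i +
          ((Finset.Ico (i + 1) N).filter fun a => s a ≤ j ∧ j < s a + r a).card ≤ k) ∧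
        (j < s i → k < r i +
          ((Finset.Ico (i + 1) N).filter fun a => s a ≤ j ∧ j < s a + r a).card)) := by
  induction hm using Nat.decreasingInduction with
  | self =>
    refine ⟨fun _ => 0, rfl, ?_, ?_, ?_⟩
    · intro a b h1 h2 h3
      have := hr h2
      simpa using this
    · simp only [Finset.Ico_self, Finset.filter_empty, Finset.card_empty]
      exact antitone_const
    · intro i h1 h2
      omega
  | of_succ m hm ih =>
    obtain ⟨s, hs0, hs, hc, hh⟩ := ih
    set c : ℕ → ℕ := fun j =>
      ((Finset.Ico (m + 1) N).filter fun a => s a ≤ j ∧ j < s a + r a).card with hcdef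
    have hzero : ∀ j, s (m + 1) + r (m + 1) ≤ j → c j = 0 := by
      intro j hj
      simp only [hcdef, Finset.card_eq_zero, Finset.filter_eq_empty_iff, Finset.mem_Ico]
      intro a ha
      have := hs (m + 1) a le_rfl ha.1 ha.2.le
      omega
    have hrm : r m ≤ k := (hr (Nat.zero_le m)).trans hk
    have hex : ∃ q, r m + c q ≤ k := ⟨s (m + 1) + r (m + 1), by rw [hzero _ le_rfl]; omega⟩
    classical
    set p := Nat.find hex with hp
    have hp1 : r m + c p ≤ k := Nat.find_spec hex
    have hp2 : ∀ q, q < p → k < r m + c q := fun q hq => not_le.mp (Nat.find_min hex hq)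
    have hrm1 : r (m + 1) ≤ r m := hr (Nat.le_succ m)
    have hps : s (m + 1) ≤ p := by
      by_contra! h
      rcases Nat.lt_or_ge (m + 1) N with h1 | h1
      · have h2 := (hh (m + 1) le_rfl h1 p).2 h
        have h3 : ((Finset.Ico (m + 1 + 1) N).filter fun a => s a ≤ p ∧ p < s a + r a).card ≤ c p :=
          Finset.card_le_card (Finset.filter_subset_filter _
            (Finset.Ico_subset_Ico_left (Nat.le_succ _)))
        omega
      · obtain rfl : m + 1 = N := by omega
        omega
    have hu : ∀ a, a ≠ m → Function.update s m p a = s a := fun a ha =>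
      Function.update_of_ne ha _ _
    have hum : Function.update s m p m = p := Function.update_self _ _ _
    have hcol : ∀ i, m ≤ i → ∀ j,
        ((Finset.Ico (i + 1) N).filter fun a => Function.update s m p a ≤ j ∧
          j < Function.update s m p a + r a) =
        ((Finset.Ico (i + 1) N).filter fun a => s a ≤ j ∧ j < s a + r a) := by
      intro i hi j
      refine Finset.filter_congr fun a ha => ?_
      rw [hu a (by have := (Finset.mem_Ico.mp ha).1; omega)]
    have hcol' : ∀ j, ((Finset.Ico m N).filter fun a => Function.update s m p a ≤ j ∧
          j < Function.update s m p a + r a).card =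
        (if p ≤ j ∧ j < p + r m then 1 else 0) + c j := by
      intro j
      rw [← Finset.insert_Ico_add_one_left_eq_Ico hm, Finset.filter_insert, hum, hcol m le_rfl]
      split_ifs with h
      · rw [Finset.card_insert_of_notMem (by simp), add_comm]
      · rw [zero_add]
    refine ⟨Function.update s m p, ?_, ?_, ?_, ?_⟩
    · rw [hu N (by omega), hs0]
    · intro a b h1 h2 h3
      rcases eq_or_ne a m with rfl | ha
      · rcases eq_or_ne b a with rfl | hb
        · exact ⟨le_rfl, le_rfl⟩
        · have := hs (a + 1) b le_rfl (by omega) h3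
          rw [hu b hb, hum]
          omega
      · rw [hu a ha, hu b (by omega)]
        exact hs a b (by omega) h2 h3
    · intro x y hxy
      simp only [hcol']
      have h1 : c y ≤ c x := hc hxy
      rcases Nat.lt_or_ge x p with hx | hx
      · have h2 := hp2 x hx
        rcases Nat.lt_or_ge y p with hy | hy
        · split_ifs <;> omega
        · have h3 : c y ≤ c p := hc hy
          split_ifs <;> omega
      · rcases Nat.lt_or_ge y (p + r m) with hy | hy
        · split_ifs <;> omega
        · have := hzero y (by omega)
          split_ifs <;> omega
    · intro i h1 h2 j
      rw [hcol i h1]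
      rcases eq_or_ne i m with rfl | hi
      · rw [hum]
        refine ⟨fun h => ?_, fun h => hp2 j h⟩
        have : c j ≤ c p := hc h
        change r i + c j ≤ k
        omega
      · rw [hu i hi]
        exact hh i (by omega) h2 j

theorem exists_isKSkew (k : ℕ) (lam : KBoundedPartition k) :
    ∃ D, IsKSkew k lam.diagram D ∧ Antitone D.colCount := by
  set N := lam.diagram.colLen 0
  have hN : lam.diagram.rowLen N = 0 := rowLen_colLen_zero _
  have hr : Antitone lam.diagram.rowLen := fun a b h => lam.diagram.rowLen_anti a b h
  obtain ⟨s, hs0, hs, hc, hh⟩ :=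
    exists_starts k N lam.diagram.rowLen hr hN lam.bounded 0 (Nat.zero_le _)
  set r := lam.diagram.rowLen
  let t : ℕ → ℕ := fun i => s (min i N)
  have ht : Antitone t := fun a b h => (hs _ _ (Nat.zero_le _)
    (min_le_min_right N h) (min_le_right _ _)).1
  have htr : Antitone fun i => t i + r i := by
    intro a b h
    rcases Nat.lt_or_ge b N with hb | hb
    · have := (hs a b (Nat.zero_le _) h hb.le).2
      simp only [t, min_eq_left hb.le, min_eq_left (h.trans hb.le)]
      exact this
    · have h1 : r b = 0 := Nat.le_zero.mp (hN ▸ hr hb)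
      have := ht h
      simp only [h1]
      omega
  have htN : t N = 0 := by simp only [t, min_self, hs0]
  let D : SkewDiagram :=
    { outer := ofRows (fun i => t i + r i) htr N (by simp only [htN, hN])
      inner := ofRows t ht N htN
      inner_le := by
        rintro ⟨a, b⟩ h
        have h' : (a, b) ∈ ofRows t ht N htN := h
        rw [mem_ofRows] at h' ⊢
        omega }
  have hDi : ∀ i, D.inner.rowLen i = t i := fun i => rowLen_ofRows t ht N htN i
  have hDo : ∀ i, D.outer.rowLen i = t i + r i := fun i =>
    rowLen_ofRows (fun i => t i + r i) htr N (by simp only [htN, hN]) i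
  have hDN : D.outer.rowLen N = 0 := by rw [hDo, htN, hN]
  have hcf : ∀ i j, (D.colFrom i j).card =
      ((Finset.Ico i N).filter fun a => s a ≤ j ∧ j < s a + r a).card := by
    intro i j
    rw [colFrom_card D i j N hDN]
    refine congrArg Finset.card ?_
    refine Finset.filter_congr fun a ha => ?_
    rw [hDi, hDo]
    simp only [t, min_eq_left (Finset.mem_Ico.mp ha).2.le]
  have hlt : ∀ i j, j < t i + r i → i < N := by
    intro i j h
    by_contra! hi
    have : t i + r i ≤ t N + r N := htr hi
    rw [htN, hN] at this
    omega
  refine ⟨D, ⟨fun i => ?_, ?_, ?_⟩, ?_⟩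
  · rw [rowCount_eq, hDi, hDo]
    change t i + r i - t i = r i
    omega
  · rintro ⟨i, j⟩ h
    rw [mem_cells_iff, hDi, hDo] at h
    have hi := hlt i j h.2
    have h1 := (hh i (Nat.zero_le _) hi j).1 (by simpa only [t, min_eq_left hi.le] using h.1)
    rw [hookLength_eq, hcf, hDi, hDo]
    omega
  · rintro ⟨i, j⟩ h
    rw [YoungDiagram.mem_cells, YoungDiagram.mem_iff_lt_rowLen, hDi] at h
    have hi := hlt i j (by omega)
    have h1 := (hh i (Nat.zero_le _) hi j).2 (by simpa only [t, min_eq_left hi.le] using h)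
    rw [hookLength_eq, hcf, hDi, hDo, max_eq_right h.le]
    omega
  · have h : D.colCount = fun j =>
        ((Finset.Ico 0 N).filter fun a => s a ≤ j ∧ j < s a + r a).card := by
      funext j
      rw [colCount_eq, hcf]
    rw [h]
    exact hc

theorem IsKSkew.outer_rowLen {k : ℕ} {lam : YoungDiagram} {D : SkewDiagram}
    (h : IsKSkew k lam D) (i : ℕ) : D.outer.rowLen i = D.inner.rowLen i + lam.rowLen i := by
  have h1 := h.row i
  rw [rowCount_eq] at h1
  have := D.inner_rowLen_le i
  omega

theorem IsKSkew.unique {k : ℕ} {lam : YoungDiagram} {D E : SkewDiagram}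
    (hD : IsKSkew k lam D) (hE : IsKSkew k lam E) : D = E := by
  set N := max (D.outer.colLen 0) (E.outer.colLen 0)
  have hDN : D.outer.rowLen N = 0 := Nat.le_zero.mp
    (rowLen_colLen_zero D.outer ▸ D.outer.rowLen_anti _ _ (le_max_left _ _))
  have hEN : E.outer.rowLen N = 0 := Nat.le_zero.mp
    (rowLen_colLen_zero E.outer ▸ E.outer.rowLen_anti _ _ (le_max_right _ _))
  have step : ∀ {A B : SkewDiagram}, IsKSkew k lam A → IsKSkew k lam B →
      A.outer.rowLen N = 0 → B.outer.rowLen N = 0 → ∀ m,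
      (∀ i, m + 1 ≤ i → A.inner.rowLen i = B.inner.rowLen i) →
      ¬ A.inner.rowLen m < B.inner.rowLen m := by
    intro A B hA hB hAN hBN m ih hlt
    set p := A.inner.rowLen m with hp
    have hcf : (A.colFrom (m + 1) p).card = (B.colFrom (m + 1) p).card := by
      rw [colFrom_card A _ _ N hAN, colFrom_card B _ _ N hBN]
      refine congrArg Finset.card ?_
      refine Finset.filter_congr fun a ha => ?_
      rw [hA.outer_rowLen, hB.outer_rowLen, ih a (Finset.mem_Ico.mp ha).1]
    have h1 := hB.below_hook (m, p)
      (by rw [YoungDiagram.mem_cells, YoungDiagram.mem_iff_lt_rowLen]; exact hlt)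
    rw [hookLength_eq, hB.outer_rowLen, max_eq_right hlt.le, ← hcf] at h1
    rcases Nat.eq_zero_or_pos (lam.rowLen m) with h0 | h0
    · have h2 : (A.colFrom (m + 1) p).card = 0 := by
        rw [colFrom_card A _ _ N hAN, Finset.card_eq_zero, Finset.filter_eq_empty_iff]
        intro a ha
        have := lam.rowLen_anti m a (by have := (Finset.mem_Ico.mp ha).1; omega)
        rw [hA.outer_rowLen]
        omega
      omega
    · have h2 := hA.cell_hook (m, p) (by rw [mem_cells_iff, hA.outer_rowLen]; omega)
      rw [hookLength_eq, hA.outer_rowLen, ← hp, max_self] at h2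
      omega
  have key : ∀ m, m ≤ N → ∀ i, m ≤ i → D.inner.rowLen i = E.inner.rowLen i := by
    intro m hm
    induction hm using Nat.decreasingInduction with
    | self =>
      intro i hi
      have := D.outer.rowLen_anti _ _ hi
      have := E.outer.rowLen_anti _ _ hi
      have := D.inner_rowLen_le i
      have := E.inner_rowLen_le i
      omega
    | of_succ m hm ih =>
      intro i hi
      rcases eq_or_lt_of_le hi with rfl | hi
      · have h1 := step hD hE hDN hEN m ih
        have h2 := step hE hD hEN hDN m (fun i hi => (ih i hi).symm)
        omega
      · exact ih i hi
  have hin : ∀ i, D.inner.rowLen i = E.inner.rowLen i := fun i =>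
    key 0 (Nat.zero_le _) i (Nat.zero_le _)
  ext ⟨a, b⟩
  · rw [YoungDiagram.mem_cells, YoungDiagram.mem_cells, YoungDiagram.mem_iff_lt_rowLen,
      YoungDiagram.mem_iff_lt_rowLen, hD.outer_rowLen, hE.outer_rowLen, hin]
  · rw [YoungDiagram.mem_cells, YoungDiagram.mem_cells, YoungDiagram.mem_iff_lt_rowLen,
      YoungDiagram.mem_iff_lt_rowLen, hin]

theorem existsUnique_isKSkew (k : ℕ) (lam : KBoundedPartition k) :
    ∃! D, IsKSkew k lam.diagram D := by
  obtain ⟨D, hD, _⟩ := exists_isKSkew k lam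
  exact ⟨D, hD, fun E hE => hE.unique hD⟩

/-! ### The `k`-conjugate -/

namespace KBoundedPartition

variable {k : ℕ}

/-- The `k`-skew diagram of a `k`-bounded partition. -/
noncomputable def kSkew (lam : KBoundedPartition k) : SkewDiagram :=
  (existsUnique_isKSkew k lam).choose

theorem isKSkew_kSkew (lam : KBoundedPartition k) : IsKSkew k lam.diagram lam.kSkew :=
  (existsUnique_isKSkew k lam).choose_spec.1

theorem antitone_colCount (lam : KBoundedPartition k) : Antitone lam.kSkew.colCount := by
  obtain ⟨D, hD, h⟩ := exists_isKSkew k lam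
  rwa [lam.isKSkew_kSkew.unique hD]

theorem colCount_le (lam : KBoundedPartition k) (j : ℕ) : lam.kSkew.colCount j ≤ k := by
  rcases (lam.kSkew.cells.filter fun c => c.2 = j).eq_empty_or_nonempty with h | h
  · rw [SkewDiagram.colCount, h]
    exact Nat.zero_le _
  · obtain ⟨c, hc, hmin⟩ := Finset.exists_min_image _ (fun c => c.1) h
    rw [Finset.mem_filter] at hc
    refine le_trans (Finset.card_le_card ?_) (lam.isKSkew_kSkew.cell_hook c hc.1)
    intro d hd
    have h1 := hmin d hd
    rw [Finset.mem_filter] at hd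
    exact Finset.mem_filter.mpr ⟨hd.1, Or.inr ⟨hd.2.trans hc.2.symm, h1⟩⟩

/-- The `k`-conjugate: the partition given by the column lengths of the `k`-skew diagram. -/
noncomputable def kConj (lam : KBoundedPartition k) : KBoundedPartition k where
  diagram := ofRows lam.kSkew.colCount lam.antitone_colCount (lam.kSkew.outer.rowLen 0)
    (lam.kSkew.colCount_eq_zero le_rfl)
  bounded := by
    rw [rowLen_ofRows]
    exact lam.colCount_le 0

theorem rowLen_kConj (lam : KBoundedPartition k) (j : ℕ) :
    lam.kConj.diagram.rowLen j = lam.kSkew.colCount j :=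
  rowLen_ofRows _ lam.antitone_colCount _ (lam.kSkew.colCount_eq_zero le_rfl) j

end KBoundedPartition

/-! ### Union, `k`-rectangles and the `k`-Young order -/

/-- The union of two partitions: the weakly decreasing rearrangement of all their parts. -/
def unionDiagram (lam mu : YoungDiagram) : YoungDiagram :=
  YoungDiagram.ofRowLens (((lam.rowLens : Multiset ℕ) + (mu.rowLens : Multiset ℕ)).sort (· ≥ ·))
    (Multiset.pairwise_sort _ _).sortedGE

theorem rowLen_zero_ofRowLens_le {k : ℕ} {w : List ℕ} {hw : w.SortedGE} (h : ∀ a ∈ w, a ≤ k) :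
    (YoungDiagram.ofRowLens w hw).rowLen 0 ≤ k := by
  by_contra! hk
  obtain ⟨h1, h2⟩ := YoungDiagram.mem_ofRowLens.mp (YoungDiagram.mem_iff_lt_rowLen.mpr hk)
  exact absurd (h _ (List.getElem_mem h1)) (not_le.mpr h2)

theorem KBoundedPartition.le_of_mem_rowLens {k : ℕ} (lam : KBoundedPartition k) {a : ℕ}
    (h : a ∈ lam.diagram.rowLens) : a ≤ k := by
  obtain ⟨i, _, rfl⟩ := List.mem_map.mp h
  exact (lam.diagram.rowLen_anti 0 i (Nat.zero_le _)).trans lam.bounded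

instance (k : ℕ) : Union (KBoundedPartition k) where
  union lam mu :=
    { diagram := unionDiagram lam.diagram mu.diagram
      bounded := by
        refine rowLen_zero_ofRowLens_le fun a ha => ?_
        rw [Multiset.mem_sort, Multiset.mem_add] at ha
        exact ha.elim (fun h => lam.le_of_mem_rowLens h) (fun h => mu.le_of_mem_rowLens h) }

/-- The `k`-rectangle with `k - l + 1` rows of length `l`. -/
def kRectangle (k l : ℕ) (hl : l ≤ k) : KBoundedPartition k where
  diagram := YoungDiagram.ofRowLens (List.replicate (k - l + 1) l)
    (List.pairwise_replicate.mpr (Or.inr (ge_iff_le.mpr le_rfl))).sortedGE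
  bounded := rowLen_zero_ofRowLens_le fun a ha => by rw [List.eq_of_mem_replicate ha]; exact hl

/-- The covering relation of the `k`-Young lattice. -/
def KCovBy {k : ℕ} (lam mu : KBoundedPartition k) : Prop :=
  lam.diagram ≤ mu.diagram ∧ lam.kConj.diagram ≤ mu.kConj.diagram ∧
    mu.diagram.card = lam.diagram.card + 1

/-- The order of the `k`-Young lattice: the reflexive and transitive closure of `KCovBy`. -/
def KLE {k : ℕ} (lam mu : KBoundedPartition k) : Prop :=
  Relation.ReflTransGen KCovBy lam mu

end KYoung

/-! The column lengths of the `k`-skew diagram of a partition are governed by a cyclic rotation.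
Build the diagram row by row from the top, and let `N h` be the number of columns of the part built
so far that have more than `h` cells.  A new row of length `r` starts right after the columns with
more than `k - r` cells, and it reaches beyond all other nonempty columns.  Hence it moves
`N 0, …, N (k - r - 1)` one place up, puts `N (k - r) + r` in place `0`, and changes nothing above
place `k - r`: this is `addRow`.  After the last row, `N` lists the column lengths of the
`k`-conjugate (`KBoundedPartition.colLen_kConj`).

Rows of length `l` rotate the first `k - l + 1` entries of `N`, so the `k - l + 1` rows of the
rectangle complete one turn, and their effect is to add `l` to each of these entries
(`addRow_iterate_rectangle`).  This effect commutes with adding longer rows.  Consequently the union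
with the rectangle adds fixed amounts to the column lengths both of the partition and of its
`k`-conjugate (`colLen_union_kRectangle`, `colLen_kConj_union_kRectangle`), and it preserves and
reflects covers (`kCovBy_union_kRectangle_iff`).

It remains to see that a cover `mu` of `lam ∪ □` still contains the rectangle
(`KCovBy.le_count_of_union_kRectangle`).  Otherwise `lam` has no part `l`, and `mu` arises from
`lam ∪ □` by lengthening one of the rows of length `l`.  In both partitions the entry `N (k - l)` is
final once the rows of length at most `l` have been added.  If `N` is the state after the rows
shorter than `l`, this entry is `N (k - l) + l` for `lam ∪ □`, where the turn is complete, and `N 0`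
for `mu`, where it is one step short.  But `N 0 < N (k - l) + l`, because a last row of length less
than `l` reaches beyond all columns; so the `k`-conjugate of `mu` does not contain that of
`lam ∪ □`. -/

namespace KYoung

/-! ### Adding rows to column counts -/

/-- The effect of a new lowest row of length `r` on the function `N` giving, for each `h`, the
number of columns of a `k`-skew diagram that have more than `h` cells. -/
def addRow (k r : ℕ) (N : ℕ → ℕ) : ℕ → ℕ := fun h =>
  if k - r < h then N h else if h = 0 then N (k - r) + r else N (h - 1)

/-- For each `h`, the number of columns with more than `h` cells in the `k`-skew diagram whose row
lengths, from the lowest row upwards, are the entries of `L`. -/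
def colsAbove (k : ℕ) (L : List ℕ) : ℕ → ℕ := L.foldr (addRow k) 0

/-- The effect of the `k`-rectangle with rows of length `l` on the column counts. -/
def addRectangle (k l : ℕ) (N : ℕ → ℕ) : ℕ → ℕ := fun h => if h ≤ k - l then N h + l else N h

theorem colsAbove_append (k : ℕ) (L M : List ℕ) :
    colsAbove k (L ++ M) = L.foldr (addRow k) (colsAbove k M) :=
  List.foldr_append

theorem foldr_addRow_replicate (k l n : ℕ) (N : ℕ → ℕ) :
    (List.replicate n l).foldr (addRow k) N = (addRow k l)^[n] N := by
  induction n with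
  | zero => rfl
  | succ n ih => rw [List.replicate_succ, List.foldr_cons, ih, Function.iterate_succ_apply']

/-- Equal rows rotate the first `k - l + 1` entries; each entry that passes from place `k - l` to
place `0` gains `l`.  The formula is valid up to a full turn. -/
theorem addRow_iterate (k l n : ℕ) (hn : n ≤ k - l + 1) (N : ℕ → ℕ) (h : ℕ) :
    (addRow k l)^[n] N h =
      if k - l < h then N h else if h < n then N (k - l + 1 + h - n) + l else N (h - n) := by
  induction n generalizing h with
  | zero => simp
  | succ n ih =>
    rw [Function.iterate_succ_apply', addRow, ih (by omega), ih (by omega), ih (by omega)]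
    split_ifs <;> first | rfl | omega | (congr 2; omega) | (congr 1; omega)

theorem addRow_iterate_rectangle (k l : ℕ) (N : ℕ → ℕ) :
    (addRow k l)^[k - l + 1] N = addRectangle k l N := by
  funext h
  rw [addRow_iterate k l _ le_rfl, addRectangle]
  split_ifs <;> first | rfl | omega | (congr 2; omega)

theorem addRow_addRectangle {k l r : ℕ} (hr : l ≤ r) (N : ℕ → ℕ) :
    addRow k r (addRectangle k l N) = addRectangle k l (addRow k r N) := by
  funext h
  simp only [addRow, addRectangle]
  split_ifs <;> omega

theorem foldr_addRow_addRectangle {k l : ℕ} {L : List ℕ} (hL : ∀ r ∈ L, l ≤ r) (N : ℕ → ℕ) :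
    L.foldr (addRow k) (addRectangle k l N) = addRectangle k l (L.foldr (addRow k) N) := by
  induction L with
  | nil => rfl
  | cons r L ih =>
    rw [List.foldr_cons, ih fun x hx => hL x (List.mem_cons_of_mem _ hx),
      addRow_addRectangle (hL r List.mem_cons_self), List.foldr_cons]

/-- Rows longer than `l` do not change the number of columns with more than `k - l` cells. -/
theorem foldr_addRow_apply_sub {k l : ℕ} {L : List ℕ} (hL : ∀ r ∈ L, l < r ∧ r ≤ k)
    (N : ℕ → ℕ) : L.foldr (addRow k) N (k - l) = N (k - l) := by
  induction L with
  | nil => rfl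
  | cons r L ih =>
    have hr := hL r List.mem_cons_self
    rw [List.foldr_cons, addRow, if_pos (by omega),
      ih fun x hx => hL x (List.mem_cons_of_mem _ hx)]

/-- The second part says that a new lowest row of length `r`, at least as long as the others,
reaches beyond all nonempty columns.  The two parts need each other: rotating an antitone function
keeps it antitone only if the new value in place `0` is at least the old one. -/
theorem antitone_colsAbove_and_le {k : ℕ} {L : List ℕ} (hL : L.Pairwise (· ≥ ·)) :
    Antitone (colsAbove k L) ∧
      ∀ r, (∀ x ∈ L, x ≤ r) → colsAbove k L 0 ≤ colsAbove k L (k - r) + r := by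
  induction L with
  | nil => exact ⟨antitone_const, fun r _ => Nat.zero_le _⟩
  | cons b L ih =>
    rw [List.pairwise_cons] at hL
    obtain ⟨ha, hb⟩ := ih hL.2
    have h0 := hb b hL.1
    have hcons : colsAbove k (b :: L) = addRow k b (colsAbove k L) := rfl
    rw [hcons]
    refine ⟨antitone_nat_of_succ_le fun h => ?_, fun r hr => ?_⟩
    · have h1 : colsAbove k L (h + 1) ≤ colsAbove k L h := ha (Nat.le_succ h)
      have h2 := ha (Nat.sub_le h 1)
      have h3 := ha (Nat.zero_le h)
      simp only [addRow, Nat.add_sub_cancel, if_neg (Nat.succ_ne_zero h)]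
      split_ifs <;> omega
    · have hbr := hr b List.mem_cons_self
      have h1 : k - r - 1 ≤ k - b := by omega
      have h2 := ha h1
      simp only [addRow]
      split_ifs with h3 h4 h5 <;> omega

theorem colsAbove_zero_lt {k l : ℕ} {L : List ℕ} (hL : L.Pairwise (· ≥ ·)) (hl : 1 ≤ l)
    (h : ∀ x ∈ L, x < l) : colsAbove k L 0 < colsAbove k L (k - l) + l := by
  obtain ⟨ha, hb⟩ := antitone_colsAbove_and_le (k := k) hL
  have h1 := hb (l - 1) fun x hx => Nat.le_sub_one_of_lt (h x hx)
  have h2 : k - l ≤ k - (l - 1) := by omega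
  have h3 := ha h2
  omega

/-! ### Column lengths of the `k`-conjugate -/

namespace SkewDiagram

theorem card_colFrom_eq_add (D : SkewDiagram) (i j : ℕ) :
    (D.colFrom i j).card = (D.colFrom (i + 1) j).card +
      if D.inner.rowLen i ≤ j ∧ j < D.outer.rowLen i then 1 else 0 := by
  split_ifs with h
  · have : D.colFrom i j = insert (i, j) (D.colFrom (i + 1) j) := by
      ext ⟨a, b⟩
      simp only [colFrom, Finset.mem_filter, Finset.mem_insert, mem_cells_iff, Prod.mk.injEq]
      constructor
      · rintro ⟨h1, rfl, h2⟩
        rcases eq_or_lt_of_le h2 with rfl | h3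
        · exact Or.inl ⟨rfl, rfl⟩
        · exact Or.inr ⟨h1, rfl, h3⟩
      · rintro (⟨rfl, rfl⟩ | ⟨h1, rfl, h2⟩)
        · exact ⟨h, rfl, le_rfl⟩
        · exact ⟨h1, rfl, by omega⟩
    rw [this, Finset.card_insert_of_notMem (by simp [colFrom])]
  · rw [add_zero]
    refine congrArg Finset.card (Finset.filter_congr ?_)
    rintro ⟨a, b⟩ hab
    rw [mem_cells_iff] at hab
    refine and_congr_right fun (hb : b = j) => ⟨fun h2 => lt_of_le_of_ne h2 ?_, fun h2 => ?_⟩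
    · rintro (rfl : i = a)
      exact h (hb ▸ hab)
    · exact Nat.le_of_succ_le h2

theorem card_colFrom_eq_zero (D : SkewDiagram) {i j : ℕ} (h : D.outer.rowLen i ≤ j) :
    (D.colFrom i j).card = 0 := by
  rw [Finset.card_eq_zero, colFrom, Finset.filter_eq_empty_iff]
  rintro ⟨a, b⟩ hab ⟨(rfl : b = j), h2⟩
  have h3 := D.outer.rowLen_anti i a h2
  have h4 := (mem_cells_iff.mp hab).2
  omega

end SkewDiagram

open SkewDiagram

/-- The rows from `i` upwards of a `k`-skew diagram have exactly `colsAbove` columns with more than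
`h` cells, and these columns are the leftmost ones. -/
theorem IsKSkew.lt_card_colFrom_iff {k : ℕ} {lam : YoungDiagram} {D : SkewDiagram}
    (hD : IsKSkew k lam D) (hk : lam.rowLen 0 ≤ k) (n i : ℕ) (hi : i + n = lam.colLen 0)
    (j h : ℕ) : h < (D.colFrom i j).card ↔
      j < colsAbove k ((List.range' i n).map lam.rowLen) h := by
  induction n generalizing i j h with
  | zero =>
    have : (D.colFrom i j).card = 0 := by
      rw [Finset.card_eq_zero, colFrom, Finset.filter_eq_empty_iff]
      rintro ⟨a, b⟩ hab ⟨-, h2⟩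
      have h3 := lam.rowLen_anti _ _ h2
      have h4 : lam.rowLen i = 0 := by
        rw [show i = lam.colLen 0 from hi]
        exact rowLen_colLen_zero lam
      rw [mem_cells_iff, hD.outer_rowLen] at hab
      simp only at h3
      omega
    simp [this, colsAbove]
  | succ n ih =>
    have ih' := ih (i + 1) (by omega)
    rw [List.range'_succ, List.map_cons]
    change _ ↔ j < addRow k _ (colsAbove k ((List.range' (i + 1) n).map lam.rowLen)) h
    set N := colsAbove k ((List.range' (i + 1) n).map lam.rowLen)
    have hpos : 0 < lam.rowLen i := by
      rw [← YoungDiagram.mem_iff_lt_rowLen, YoungDiagram.mem_iff_lt_colLen]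
      omega
    have hr : lam.rowLen i ≤ k := (lam.rowLen_anti 0 i (Nat.zero_le _)).trans hk
    have ho := hD.outer_rowLen i
    have hend : ∀ j, D.inner.rowLen i + lam.rowLen i ≤ j → (D.colFrom (i + 1) j).card = 0 := by
      intro j hj
      refine D.card_colFrom_eq_zero ?_
      have := D.outer.rowLen_anti i (i + 1) (Nat.le_succ i)
      omega
    -- The new row starts right after the columns with more than `k - lam.rowLen i` cells.
    have hstart : D.inner.rowLen i = N (k - lam.rowLen i) := by
      refine le_antisymm ?_ ?_ <;> by_contra! hlt
      · have h1 := hD.below_hook (i, N (k - lam.rowLen i))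
          (by rw [YoungDiagram.mem_cells, YoungDiagram.mem_iff_lt_rowLen]; exact hlt)
        rw [hookLength_eq, ho, max_eq_right hlt.le] at h1
        have h2 := (ih' (N (k - lam.rowLen i)) (k - lam.rowLen i)).mp (by omega)
        omega
      · have h1 := hD.cell_hook (i, D.inner.rowLen i) (by rw [mem_cells_iff, ho]; omega)
        rw [hookLength_eq, ho, max_self] at h1
        have h2 := (ih' _ _).mpr hlt
        omega
    have h1 := ih' j (k - lam.rowLen i)
    have h2 := ih' j h
    have h3 := ih' j (h - 1)
    have h4 := hend j
    rw [D.card_colFrom_eq_add, addRow, ho]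
    split_ifs <;> omega

theorem KBoundedPartition.colLen_kConj {k : ℕ} (lam : KBoundedPartition k) :
    lam.kConj.diagram.colLen = colsAbove k lam.diagram.rowLens := by
  funext h
  have key : ∀ j, j < lam.kConj.diagram.colLen h ↔ j < colsAbove k lam.diagram.rowLens h := by
    intro j
    rw [← YoungDiagram.mem_iff_lt_colLen, YoungDiagram.mem_iff_lt_rowLen, lam.rowLen_kConj,
      colCount_eq, lam.isKSkew_kSkew.lt_card_colFrom_iff lam.bounded _ 0 (Nat.zero_add _),
      YoungDiagram.rowLens, List.range_eq_range']
  exact eq_of_forall_lt_iff key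

/-! ### Young diagrams through their column lengths -/

theorem le_iff_colLen_le {Y Z : YoungDiagram} : Y ≤ Z ↔ ∀ j, Y.colLen j ≤ Z.colLen j := by
  constructor
  · intro h j
    by_contra! hlt
    exact absurd (YoungDiagram.mem_iff_lt_colLen.mp (h (YoungDiagram.mem_iff_lt_colLen.mpr hlt)))
      (lt_irrefl _)
  · rintro h ⟨i, j⟩ hY
    exact YoungDiagram.mem_iff_lt_colLen.mpr
      ((YoungDiagram.mem_iff_lt_colLen.mp hY).trans_le (h j))

theorem countP_rowLens (Y : YoungDiagram) (j : ℕ) :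
    Y.rowLens.countP (j < ·) = Y.colLen j := by
  have h : ∀ n, (List.range n).countP (fun i => decide (i < Y.colLen j)) = min n (Y.colLen j) := by
    intro n
    induction n with
    | zero => simp
    | succ n ih =>
      rw [List.range_succ, List.countP_append, ih, List.countP_singleton]
      simp only [decide_eq_true_eq]
      split_ifs <;> omega
  rw [YoungDiagram.rowLens, List.countP_map, ← min_eq_right (Y.colLen_anti 0 j (Nat.zero_le j)),
    ← h]
  refine List.countP_congr fun i _ => ?_
  simp [← YoungDiagram.mem_iff_lt_rowLen, ← YoungDiagram.mem_iff_lt_colLen]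

theorem colLen_eq_colLen_succ_add_count (Y : YoungDiagram) (j : ℕ) :
    Y.colLen j = Y.colLen (j + 1) + Y.rowLens.count (j + 1) := by
  rw [← countP_rowLens, ← countP_rowLens]
  induction Y.rowLens with
  | nil => rfl
  | cons a L ih =>
    rw [List.countP_cons, List.countP_cons, List.count_cons, ih]
    simp only [decide_eq_true_eq, beq_iff_eq]
    split_ifs <;> omega

theorem card_eq_sum_colLen {Y : YoungDiagram} {k : ℕ} (hk : Y.rowLen 0 ≤ k) :
    Y.card = ∑ j ∈ Finset.range k, Y.colLen j := by
  rw [YoungDiagram.card, Finset.card_eq_sum_card_fiberwise (f := Prod.snd) (t := Finset.range k)]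
  · exact Finset.sum_congr rfl fun j _ => Y.colLen_eq_card.symm
  · rintro ⟨i, j⟩ h
    have h1 : (i, j) ∈ Y := h
    rw [YoungDiagram.mem_iff_lt_rowLen] at h1
    have h2 := Y.rowLen_anti 0 i (Nat.zero_le i)
    simp only [Finset.coe_range, Set.mem_Iio]
    omega

/-- If one cell is added to a diagram, then a single column becomes longer, by one cell. -/
theorem colLen_of_card_eq_succ {Y Z : YoungDiagram} (h : Y ≤ Z) (hc : Z.card = Y.card + 1)
    {j : ℕ} (hj : Y.colLen j < Z.colLen j) :
    Z.colLen j = Y.colLen j + 1 ∧ ∀ j', j' ≠ j → Y.colLen j' = Z.colLen j' := by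
  have hcard : (Z.cells \ Y.cells).card ≤ 1 := by
    rw [Finset.card_sdiff_of_subset (YoungDiagram.cells_subset_iff.mpr h)]
    change Z.card - Y.card ≤ 1
    omega
  have hmem : ∀ i a, Y.colLen a ≤ i → i < Z.colLen a → (i, a) ∈ Z.cells \ Y.cells := by
    intro i a h1 h2
    simp [YoungDiagram.mem_iff_lt_colLen, h1, h2]
  have huniq : ∀ i a, Y.colLen a ≤ i → i < Z.colLen a → (i, a) = (Y.colLen j, j) :=
    fun i a h1 h2 => Finset.card_le_one.mp hcard _ (hmem i a h1 h2) _ (hmem _ j le_rfl hj)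
  refine ⟨le_antisymm ?_ hj, fun j' hne => le_antisymm (le_iff_colLen_le.mp h j') ?_⟩ <;>
    by_contra! hlt
  · exact absurd (Prod.mk.inj (huniq _ j (Nat.le_succ _) hlt)).1 (Nat.succ_ne_self _)
  · exact hne (Prod.mk.inj (huniq _ j' le_rfl hlt)).2

/-! ### Sorted lists around a value -/

/-- A weakly decreasing list consists of its entries above `l`, those equal to `l`, and those
below `l`. -/
theorem eq_filter_append_replicate_append_filter {L : List ℕ} (hL : L.Pairwise (· ≥ ·)) (l : ℕ) :
    L = L.filter (l < ·) ++ (List.replicate (L.count l) l ++ L.filter (· < l)) := by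
  refine List.Perm.eq_of_pairwise' (r := (· ≥ ·)) hL ?_ ?_
  · rw [List.pairwise_append, List.pairwise_append]
    refine ⟨hL.filter _, ⟨List.pairwise_replicate.mpr (Or.inr le_rfl), hL.filter _, ?_⟩, ?_⟩
    · intro a ha b hb
      simp only [List.mem_replicate, List.mem_filter, decide_eq_true_eq] at ha hb
      omega
    · intro a ha b hb
      simp only [List.mem_append, List.mem_replicate, List.mem_filter, decide_eq_true_eq] at ha hb
      omega
  · refine List.perm_iff_count.mpr fun x => ?_
    rw [List.count_append, List.count_append, List.count_replicate]
    rcases lt_trichotomy x l with h | rfl | h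
    · rw [List.count_eq_zero_of_not_mem (a := x) (l := L.filter (l < ·)) (by simp [h.le]),
        List.count_filter (by simpa using h)]
      simp [h.ne']
    · rw [List.count_eq_zero_of_not_mem (a := x) (l := L.filter (x < ·)) (by simp),
        List.count_eq_zero_of_not_mem (a := x)
        (l := L.filter (· < x)) (by simp)]
      simp
    · rw [List.count_eq_zero_of_not_mem (a := x) (l := L.filter (· < l)) (by simp [h.le]),
        List.count_filter (by simpa using h)]
      simp [h.ne]

theorem filter_eq_filter_of_count_eq {L M : List ℕ} (hL : L.Pairwise (· ≥ ·))
    (hM : M.Pairwise (· ≥ ·)) (p : ℕ → Bool) (h : ∀ x, p x → L.count x = M.count x) :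
    L.filter p = M.filter p := by
  refine List.Perm.eq_of_pairwise' (r := (· ≥ ·)) (hL.filter _) (hM.filter _)
    (List.perm_iff_count.mpr fun x => ?_)
  by_cases hx : p x
  · rw [List.count_filter hx, List.count_filter hx, h x hx]
  · rw [List.count_eq_zero_of_not_mem (by simp [hx]), List.count_eq_zero_of_not_mem (by simp [hx])]

/-! ### Union with a rectangle -/

theorem rowLens_unionDiagram (Y Z : YoungDiagram) :
    ((unionDiagram Y Z).rowLens : Multiset ℕ) = Y.rowLens + Z.rowLens := by
  rw [unionDiagram, YoungDiagram.rowLens_ofRowLens_eq_self, Multiset.sort_eq]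
  intro x hx
  rw [Multiset.mem_sort, Multiset.mem_add] at hx
  exact hx.elim (Y.pos_of_mem_rowLens x) (Z.pos_of_mem_rowLens x)

theorem diagram_ext_of_rowLens {Y Z : YoungDiagram}
    (h : (Y.rowLens : Multiset ℕ) = Z.rowLens) : Y = Z :=
  YoungDiagram.equivListRowLens.injective (Subtype.ext
    ((Multiset.coe_eq_coe.mp h).eq_of_sortedGE Y.rowLens_sorted Z.rowLens_sorted))

variable {k l : ℕ}

theorem rowLens_kRectangle (hl : 1 ≤ l) (hlk : l ≤ k) :
    (kRectangle k l hlk).diagram.rowLens = List.replicate (k - l + 1) l := by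
  rw [kRectangle, YoungDiagram.rowLens_ofRowLens_eq_self]
  intro x hx
  rw [List.eq_of_mem_replicate hx]
  exact hl

theorem rowLens_union_kRectangle (hl : 1 ≤ l) (hlk : l ≤ k) (lam : KBoundedPartition k) :
    (lam ∪ kRectangle k l hlk).diagram.rowLens.Perm
      (lam.diagram.rowLens ++ List.replicate (k - l + 1) l) := by
  rw [← Multiset.coe_eq_coe, ← Multiset.coe_add, ← rowLens_kRectangle hl hlk]
  exact rowLens_unionDiagram _ _

theorem count_union_kRectangle (hl : 1 ≤ l) (hlk : l ≤ k) (lam : KBoundedPartition k) (x : ℕ) :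
    (lam ∪ kRectangle k l hlk).diagram.rowLens.count x =
      lam.diagram.rowLens.count x + if x = l then k - l + 1 else 0 := by
  rw [(rowLens_union_kRectangle hl hlk lam).count_eq, List.count_append, List.count_replicate]
  simp only [beq_iff_eq, eq_comm (a := l)]

theorem colLen_union_kRectangle (hl : 1 ≤ l) (hlk : l ≤ k) (lam : KBoundedPartition k) (j : ℕ) :
    (lam ∪ kRectangle k l hlk).diagram.colLen j =
      lam.diagram.colLen j + if j < l then k - l + 1 else 0 := by
  rw [← countP_rowLens, (rowLens_union_kRectangle hl hlk lam).countP_eq, List.countP_append,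
    countP_rowLens, List.countP_replicate]
  simp only [decide_eq_true_eq]

theorem card_union_kRectangle (hl : 1 ≤ l) (hlk : l ≤ k) (lam : KBoundedPartition k) :
    (lam ∪ kRectangle k l hlk).diagram.card =
      lam.diagram.card + ∑ j ∈ Finset.range k, if j < l then k - l + 1 else 0 := by
  rw [card_eq_sum_colLen (lam ∪ kRectangle k l hlk).bounded, card_eq_sum_colLen lam.bounded,
    ← Finset.sum_add_distrib]
  exact Finset.sum_congr rfl fun j _ => colLen_union_kRectangle hl hlk lam j

theorem colLen_kConj_union_kRectangle (hl : 1 ≤ l) (hlk : l ≤ k) (lam : KBoundedPartition k) :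
    (lam ∪ kRectangle k l hlk).kConj.diagram.colLen =
      addRectangle k l lam.kConj.diagram.colLen := by
  have hL := lam.diagram.rowLens_sorted.pairwise
  have hU := (lam ∪ kRectangle k l hlk).diagram.rowLens_sorted.pairwise
  have hc := count_union_kRectangle hl hlk lam
  rw [lam.colLen_kConj, (lam ∪ kRectangle k l hlk).colLen_kConj,
    eq_filter_append_replicate_append_filter hU l,
    filter_eq_filter_of_count_eq hU hL (l < ·) fun x hx => by
      rw [hc, if_neg (by simp only [decide_eq_true_eq] at hx; omega), add_zero],
    filter_eq_filter_of_count_eq hU hL (· < l) fun x hx => by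
      rw [hc, if_neg (by simp only [decide_eq_true_eq] at hx; omega), add_zero],
    hc, if_pos rfl]
  conv_rhs => rw [eq_filter_append_replicate_append_filter hL l]
  rw [colsAbove_append, colsAbove_append, colsAbove_append, colsAbove_append,
    List.replicate_add, List.foldr_append, foldr_addRow_replicate k l (k - l + 1),
    addRow_iterate_rectangle, ← List.foldr_append, ← List.foldr_append, foldr_addRow_addRectangle]
  intro r hr
  simp only [List.mem_append, List.mem_filter, List.mem_replicate, decide_eq_true_eq] at hr
  omega

/-- Union with a `k`-rectangle preserves and reflects covers. -/
theorem kCovBy_union_kRectangle_iff (hl : 1 ≤ l) (hlk : l ≤ k) {lam nu : KBoundedPartition k} :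
    KCovBy (lam ∪ kRectangle k l hlk) (nu ∪ kRectangle k l hlk) ↔ KCovBy lam nu := by
  refine and_congr ?_ (and_congr ?_ ?_)
  · simp only [le_iff_colLen_le, colLen_union_kRectangle hl, add_le_add_iff_right]
  · simp only [le_iff_colLen_le, colLen_kConj_union_kRectangle hl]
    refine forall_congr' fun h => ?_
    simp only [addRectangle]
    split_ifs <;> omega
  · rw [card_union_kRectangle hl, card_union_kRectangle hl]
    omega

/-- A partition that has the part `l` at least `k - l + 1` times is a union with the rectangle. -/
theorem exists_eq_union_kRectangle (hl : 1 ≤ l) (hlk : l ≤ k) (mu : KBoundedPartition k)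
    (h : k - l + 1 ≤ mu.diagram.rowLens.count l) :
    ∃ nu : KBoundedPartition k, mu = nu ∪ kRectangle k l hlk := by
  set S : Multiset ℕ := (mu.diagram.rowLens : Multiset ℕ) - Multiset.replicate (k - l + 1) l
    with hS
  have hsub : ∀ x ∈ S.sort (· ≥ ·), x ∈ mu.diagram.rowLens := fun x hx =>
    Multiset.mem_coe.mp (Multiset.mem_of_le (Multiset.sub_le_self _ _) ((Multiset.mem_sort _).mp hx))
  have hle : Multiset.replicate (k - l + 1) l ≤ (mu.diagram.rowLens : Multiset ℕ) := by
    rw [← Multiset.le_count_iff_replicate_le, Multiset.coe_count]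
    exact h
  refine ⟨⟨YoungDiagram.ofRowLens (S.sort (· ≥ ·)) (Multiset.pairwise_sort _ _).sortedGE,
    rowLen_zero_ofRowLens_le fun a ha => mu.le_of_mem_rowLens (hsub a ha)⟩,
    KBoundedPartition.ext (diagram_ext_of_rowLens ?_)⟩
  refine Eq.trans ?_ (rowLens_unionDiagram _ _).symm
  rw [rowLens_kRectangle hl hlk, YoungDiagram.rowLens_ofRowLens_eq_self fun x hx =>
    mu.diagram.pos_of_mem_rowLens x (hsub x hx), Multiset.sort_eq, Multiset.coe_replicate,
    hS, Multiset.sub_add_cancel hle]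

/-- The parts greater than `l` have no influence on the number of columns of the `k`-skew diagram
with more than `k - l` cells. -/
theorem KBoundedPartition.colLen_kConj_sub (mu : KBoundedPartition k) :
    mu.kConj.diagram.colLen (k - l) = (addRow k l)^[mu.diagram.rowLens.count l]
      (colsAbove k (mu.diagram.rowLens.filter (· < l))) (k - l) := by
  rw [mu.colLen_kConj]
  conv_lhs => rw [eq_filter_append_replicate_append_filter mu.diagram.rowLens_sorted.pairwise l]
  rw [colsAbove_append, foldr_addRow_apply_sub, colsAbove_append, foldr_addRow_replicate]
  intro r hr
  simp only [List.mem_filter, decide_eq_true_eq] at hr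
  exact ⟨hr.2, mu.le_of_mem_rowLens hr.1⟩

/-- A cover of a union with the rectangle still contains the rectangle. -/
theorem KCovBy.le_count_of_union_kRectangle (hl : 1 ≤ l) (hlk : l ≤ k)
    {lam mu : KBoundedPartition k} (h : KCovBy (lam ∪ kRectangle k l hlk) mu) :
    k - l + 1 ≤ mu.diagram.rowLens.count l := by
  by_contra! hlt
  obtain ⟨hle, hconj, hcard⟩ := h
  have hc := count_union_kRectangle hl hlk lam l
  rw [if_pos rfl] at hc
  set U := lam ∪ kRectangle k l hlk
  obtain ⟨q, rfl⟩ : ∃ q, l = q + 1 := ⟨l - 1, by omega⟩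
  have hU := colLen_eq_colLen_succ_add_count U.diagram q
  have hM := colLen_eq_colLen_succ_add_count mu.diagram q
  have hq := le_iff_colLen_le.mp hle q
  -- As `q + 1` has become rarer, the new cell lies in column `q + 1`: it lengthens a row of length
  -- `q + 1`, and the shorter rows are the same in both partitions.
  obtain ⟨hnew, hcol⟩ := colLen_of_card_eq_succ hle hcard (j := q + 1) (by omega)
  have hq' := hcol q (by omega)
  have hfilter : mu.diagram.rowLens.filter (· < q + 1) = U.diagram.rowLens.filter (· < q + 1) := by
    refine filter_eq_filter_of_count_eq mu.diagram.rowLens_sorted.pairwise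
      U.diagram.rowLens_sorted.pairwise _ fun x hx => ?_
    rw [decide_eq_true_eq] at hx
    rcases Nat.eq_zero_or_pos x with rfl | hx0
    · rw [List.count_eq_zero_of_not_mem fun h => (mu.diagram.pos_of_mem_rowLens 0 h).false,
        List.count_eq_zero_of_not_mem fun h => (U.diagram.pos_of_mem_rowLens 0 h).false]
    · obtain ⟨y, rfl⟩ : ∃ y, x = y + 1 := ⟨x - 1, by omega⟩
      have h1 := colLen_eq_colLen_succ_add_count U.diagram y
      have h2 := colLen_eq_colLen_succ_add_count mu.diagram y
      have h3 := hcol y (by omega)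
      have h4 := hcol (y + 1) (by omega)
      omega
  -- The rotation is complete for the union and one step short of complete for `mu`.
  have hstate := le_iff_colLen_le.mp hconj (k - (q + 1))
  have hlast := colsAbove_zero_lt (k := k) (L := U.diagram.rowLens.filter (· < q + 1))
    (U.diagram.rowLens_sorted.pairwise.filter _) hl fun x hx => by
      simpa using (List.mem_filter.mp hx).2
  rw [KBoundedPartition.colLen_kConj_sub, KBoundedPartition.colLen_kConj_sub, hfilter,
    show U.diagram.rowLens.count (q + 1) = k - (q + 1) + 1 by omega,
    show mu.diagram.rowLens.count (q + 1) = k - (q + 1) by omega,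
    addRow_iterate_rectangle, addRectangle, if_pos le_rfl, addRow_iterate _ _ _ (by omega),
    if_neg (lt_irrefl _), if_neg (lt_irrefl _), Nat.sub_self] at hstate
  omega

end KYoung

theorem mainTheorem1 (k l : ℕ) (hl : 1 ≤ l) (hlk : l ≤ k) (lam mu : KYoung.KBoundedPartition k) :
    (KYoung.KLE (lam ∪ KYoung.kRectangle k l hlk) mu ↔
      ∃ nu : KYoung.KBoundedPartition k,
        mu = nu ∪ KYoung.kRectangle k l hlk ∧ KYoung.KLE lam nu) ∧
    (KYoung.KCovBy (lam ∪ KYoung.kRectangle k l hlk) mu ↔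
      ∃ nu : KYoung.KBoundedPartition k,
        mu = nu ∪ KYoung.kRectangle k l hlk ∧ KYoung.KCovBy lam nu) := by
  have hcov : ∀ lam mu : KYoung.KBoundedPartition k,
      KYoung.KCovBy (lam ∪ KYoung.kRectangle k l hlk) mu ↔
        ∃ nu, mu = nu ∪ KYoung.kRectangle k l hlk ∧ KYoung.KCovBy lam nu := by
    refine fun lam mu => ⟨fun h => ?_, ?_⟩
    · obtain ⟨nu, rfl⟩ := KYoung.exists_eq_union_kRectangle hl hlk mu
        (h.le_count_of_union_kRectangle hl hlk)
      exact ⟨nu, rfl, (KYoung.kCovBy_union_kRectangle_iff hl hlk).mp h⟩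
    · rintro ⟨nu, rfl, h⟩
      exact (KYoung.kCovBy_union_kRectangle_iff hl hlk).mpr h
  refine ⟨⟨fun h => ?_, ?_⟩, hcov lam mu⟩
  · induction h with
    | refl => exact ⟨lam, rfl, Relation.ReflTransGen.refl⟩
    | tail _ h ih =>
      obtain ⟨nu, rfl, hnu⟩ := ih
      obtain ⟨rho, rfl, hrho⟩ := (hcov _ _).mp h
      exact ⟨rho, rfl, hnu.tail hrho⟩
  · rintro ⟨nu, rfl, h⟩
    exact Relation.ReflTransGen.lift (· ∪ KYoung.kRectangle k l hlk)
      (fun _ _ => (KYoung.kCovBy_union_kRectangle_iff hl hlk).mpr) _ _ h
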